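/- Let $\mathcal H_S,\mathcal H_M$ be finite-dimensional Hilbert spaces (system and memory) with Hamiltonians $H_S,H_M$, and let $k_BT>0$. Write $S(\rho)=-\mathrm{tr}[\rho\ln\rho]$ for the von Neumann entropy and $F_M(\rho)=\mathrm{tr}[H_M\rho]-k_BT\,S(\rho)$ for the free energy. Let $\{M_{ki}\}$ be a general (possibly inefficient) measurement on $S$ with finitely many outcomes $k$, i.e. $\sum_{k,i}M_{ki}^\dagger M_{ki}=\mathbb 1$. On a state $\rho_S$ it has outcome probabilities $p_k=\sum_i\mathrm{tr}[M_{ki}\rho_SM_{ki}^\dagger]$, post-measurement states $\rho'_{S,k}=\sum_iM_{ki}\rho_SM_{ki}^\dagger/p_k$, average post-measurement state $\rho'_S=\sum_kp_k\rho'_{S,k}$, and system energy change $\Delta E_S=\mathrm{tr}[H_S(\rho'_S-\rho_S)]$. (Outcomes with $p_k=0$ contribute $0$ to all averages.) Let $(\rho_M,U_{SM},\{Q_k\})$ be an implementation of $\{M_{ki}\}$: $\rho_M$ is a state of $M$, $U_{SM}$ is unitary on $\mathcal H_S\otimes\mathcal H_M$, the $Q_k$ are orthogonal projections on $\mathcal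 H_M$ with $\sum_kQ_k=\mathbb 1$, and $$\mathrm{tr}_M\big[(\mathbb 1\otimes Q_k)U_{SM}(\rho\otimes\rho_M)U_{SM}^\dagger\big]=\sum_iM_{ki}\rho M_{ki}^\dagger\qquad\text{for all states }\rho\text{ on }S\text{ and all }k.$$ For an input state $\rho_S$ put $\rho'_{SM}=\sum_k(\mathbb 1\otimes Q_k)U_{SM}(\rho_S\otimes\rho_M)U_{SM}^\dagger(\mathbb 1\otimes Q_k)$ and $\rho'_M=\mathrm{tr}_S[\rho'_{SM}]$. The measurement step costs $\Delta E_{\mathcal M}=\Delta E_S+\mathrm{tr}[H_M(\rho'_M-\rho_M)]$. The memory is then reset to $\rho_M$ at a cost $\Delta E_{\mathcal R}$, where either (a) the resetting step is the idealised optimal one, $\Delta E_{\mathcal R}=-\big(F_M(\rho'_M)-F_M(\rho_M)\big)$; or (b) the resetting step is any process with a finite-dimensional thermal bath: there are a Hamiltonian $H_B$ on a finite-dimensional $\mathcal H_B$, with $\rho_B=e^{-H_B/k_BT}/\mathrm{tr}[e^{-H_B/k_BT}]$, and a unitary $U_{MB}$ on $\mathcal H_M\otimes\mathcal H_B$ such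 that, with $\rho'_{MB}=\rho'_M\otimes\rho_B$ and $\rho''_{MB}=U_{MB}\rho'_{MB}U_{MB}^\dagger$, one has $\mathrm{tr}_B[\rho''_{MB}]=\rho_M$, and $\Delta E_{\mathcal R}=\mathrm{tr}[(H_M+H_B)(\rho''_{MB}-\rho'_{MB})]$. Then, in both cases, the total cost $E_{\rm cost}=\Delta E_{\mathcal M}+\Delta E_{\mathcal R}$ satisfies $$E_{\rm cost}\;\ge\;\Delta E_S+k_BT\Big[S(\rho_S)-\sum_kp_k\,S(\rho'_{S,k})\Big].$$ -/

import Mathlib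

open scoped Matrix Kronecker ComplexOrder

namespace MeasurementCost

noncomputable section

/-! ## States, partial traces, entropy, energy -/

/-- Density matrices: positive semidefinite with unit trace. -/
structure IsState {n : Type*} [Fintype n] (ρ : Matrix n n ℂ) : Prop where
  posSemidef : ρ.PosSemidef
  trace_eq_one : ρ.trace = 1

/-- Partial trace over the first tensor factor. -/
def traceFst {a b : Type*} [Fintype a] (X : Matrix (a × b) (a × b) ℂ) : Matrix b b ℂ :=
  Matrix.of fun i j => ∑ x, X (x, i) (x, j)

/-- Partial trace over the second tensor factor. -/
def traceSnd {a b : Type*} [Fintype b] (X : Matrix (a × b) (a × b) ℂ) : Matrix a a ℂ :=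
  Matrix.of fun i j => ∑ y, X (i, y) (j, y)

/-- Von Neumann entropy `S(ρ) = -tr[ρ ln ρ]`, with `ln ρ` given by the functional calculus of the
Hermitian matrix `ρ` (and `0 ln 0 = 0`). -/
def entropy {n : Type*} [Fintype n] [DecidableEq n] (ρ : Matrix n n ℂ) : ℝ :=
  -(ρ * cfc Real.log ρ).trace.re

/-- Expected energy `tr[H ρ]`. -/
def energy {n : Type*} [Fintype n] (H ρ : Matrix n n ℂ) : ℝ :=
  (H * ρ).trace.re

/-- Free energy `F(ρ) = tr[H ρ] - k_B T S(ρ)`; the argument `kT` is `k_B T`. -/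
def freeEnergy {n : Type*} [Fintype n] [DecidableEq n] (kT : ℝ) (H ρ : Matrix n n ℂ) : ℝ :=
  energy H ρ - kT * entropy ρ

/-- Thermal (Gibbs) state `e^{-H/(k_B T)} / tr[e^{-H/(k_B T)}]`; the argument `kT` is `k_B T`. -/
def thermalState {n : Type*} [Fintype n] [DecidableEq n] (kT : ℝ) (H : Matrix n n ℂ) :
    Matrix n n ℂ :=
  ((NormedSpace.exp (-((kT⁻¹ : ℝ) : ℂ) • H)).trace)⁻¹ •
    NormedSpace.exp (-((kT⁻¹ : ℝ) : ℂ) • H)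

/-! ## Measurement specification -/

/-- A general (possibly inefficient) measurement: a finite family of operators `M k i`, where `k` is
the outcome and `i` ranges over a finite set that may depend on `k`, with `∑ M_{ki}† M_{ki} = 1`. -/
structure Measurement (s κ : Type*) (ι : κ → Type*) [Fintype s] [DecidableEq s]
    [Fintype κ] [∀ k, Fintype (ι k)] where
  op : ∀ k, ι k → Matrix s s ℂ
  complete : ∑ k, ∑ i, (op k i)ᴴ * op k i = 1

namespace Measurement

variable {s κ : Type*} {ι : κ → Type*} [Fintype s] [DecidableEq s] [Fintype κ]
  [∀ k, Fintype (ι k)]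

/-- The unnormalised post-measurement state `∑_i M_{ki} ρ M_{ki}†`. -/
def branch (M : Measurement s κ ι) (ρ : Matrix s s ℂ) (k : κ) : Matrix s s ℂ :=
  ∑ i, M.op k i * ρ * (M.op k i)ᴴ

/-- Outcome probability `p_k = ∑_i tr[M_{ki} ρ M_{ki}†]`. -/
def prob (M : Measurement s κ ι) (ρ : Matrix s s ℂ) (k : κ) : ℝ :=
  (∑ i, (M.op k i * ρ * (M.op k i)ᴴ).trace).re

/-- Post-measurement state `ρ'_{S,k} = ∑_i M_{ki} ρ M_{ki}† / p_k`; it is the zero matrix for an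
outcome of probability zero, and is only used with weight `p_k`. -/
def post (M : Measurement s κ ι) (ρ : Matrix s s ℂ) (k : κ) : Matrix s s ℂ :=
  (((M.prob ρ k)⁻¹ : ℝ) : ℂ) • M.branch ρ k

/-- Average post-measurement state `ρ'_S = ∑_k p_k ρ'_{S,k}`. -/
def avgPost (M : Measurement s κ ι) (ρ : Matrix s s ℂ) : Matrix s s ℂ :=
  ∑ k, ((M.prob ρ k : ℝ) : ℂ) • M.post ρ k

/-- Energy change of the system, `ΔE_S = tr[H_S (ρ'_S - ρ_S)]`. -/
def systemEnergyChange (M : Measurement s κ ι) (HS ρ : Matrix s s ℂ) : ℝ :=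
  energy HS (M.avgPost ρ - ρ)

/-- Average entropy decrease `S(ρ_S) - ∑_k p_k S(ρ'_{S,k})`. -/
def entropyDecrease (M : Measurement s κ ι) (ρ : Matrix s s ℂ) : ℝ :=
  entropy ρ - ∑ k, M.prob ρ k * entropy (M.post ρ k)

end Measurement

/-! ## Physical implementation: measurement step -/

/-- A measurement device `(ρ_M, U_SM, {Q_k})`: initial memory state, unitary interaction of the
system with the memory, and orthogonal projections on the memory summing to the identity. -/
structure Device (s m κ : Type*) [Fintype s] [DecidableEq s] [Fintype m] [DecidableEq m]
    [Fintype κ] where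
  memory : Matrix m m ℂ
  memory_isState : IsState memory
  unitary : Matrix (s × m) (s × m) ℂ
  unitary_mem : unitary ∈ Matrix.unitaryGroup (s × m) ℂ
  proj : κ → Matrix m m ℂ
  proj_isStarProjection : ∀ k, IsStarProjection (proj k)
  proj_sum : ∑ k, proj k = 1

namespace Device

variable {s m κ : Type*} [Fintype s] [DecidableEq s] [Fintype m] [DecidableEq m] [Fintype κ]

/-- The joint state `U_SM (ρ_S ⊗ ρ_M) U_SM†` before the projections. -/
def evolved (D : Device s m κ) (ρ : Matrix s s ℂ) : Matrix (s × m) (s × m) ℂ :=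
  D.unitary * (ρ ⊗ₖ D.memory) * D.unitaryᴴ

/-- Implementation requirement: for every input state and every outcome `k`,
`tr_M[(1 ⊗ Q_k) U_SM (ρ_S ⊗ ρ_M) U_SM†] = ∑_i M_{ki} ρ_S M_{ki}†`. -/
def Implements {ι : κ → Type*} [∀ k, Fintype (ι k)] (D : Device s m κ)
    (M : Measurement s κ ι) : Prop :=
  ∀ ρ : Matrix s s ℂ, IsState ρ → ∀ k,
    traceSnd (((1 : Matrix s s ℂ) ⊗ₖ D.proj k) * D.evolved ρ) = M.branch ρ k

/-- State of system and memory after the measurement step,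
`ρ'_SM = ∑_k (1 ⊗ Q_k) U_SM (ρ_S ⊗ ρ_M) U_SM† (1 ⊗ Q_k)`. -/
def finalState (D : Device s m κ) (ρ : Matrix s s ℂ) : Matrix (s × m) (s × m) ℂ :=
  ∑ k, ((1 : Matrix s s ℂ) ⊗ₖ D.proj k) * D.evolved ρ * ((1 : Matrix s s ℂ) ⊗ₖ D.proj k)

/-- Memory state after the measurement step, `ρ'_M = tr_S[ρ'_SM]`. -/
def finalMemory (D : Device s m κ) (ρ : Matrix s s ℂ) : Matrix m m ℂ :=
  traceFst (D.finalState ρ)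

/-- Cost of the measurement step, `ΔE_M = ΔE_S + tr[H_M (ρ'_M - ρ_M)]`. -/
def measurementCost {ι : κ → Type*} [∀ k, Fintype (ι k)] (D : Device s m κ)
    (M : Measurement s κ ι) (HS : Matrix s s ℂ) (HM : Matrix m m ℂ) (ρ : Matrix s s ℂ) : ℝ :=
  M.systemEnergyChange HS ρ + energy HM (D.finalMemory ρ - D.memory)

/-- Cost `ΔE_R = -ΔF_M = -(F_M(ρ'_M) - F_M(ρ_M))` of an optimal resetting step. -/
def optimalResetCost (D : Device s m κ) (kT : ℝ) (HM : Matrix m m ℂ) (ρ : Matrix s s ℂ) : ℝ :=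
  -(freeEnergy kT HM (D.finalMemory ρ) - freeEnergy kT HM D.memory)

end Device

/-! ## Physical implementation: resetting step -/

/-- The resources of a resetting step: a bath with Hamiltonian `H_B`, and a unitary on memory and
bath. -/
structure ResetProcess (m b : Type*) [Fintype m] [DecidableEq m] [Fintype b] [DecidableEq b] where
  bathHamiltonian : Matrix b b ℂ
  bathHamiltonian_isHermitian : bathHamiltonian.IsHermitian
  unitary : Matrix (m × b) (m × b) ℂ
  unitary_mem : unitary ∈ Matrix.unitaryGroup (m × b) ℂ

namespace ResetProcess

variable {m b : Type*} [Fintype m] [DecidableEq m] [Fintype b] [DecidableEq b]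

/-- `ρ'_MB = σ ⊗ ρ_B`, where `σ` is the memory state before the reset and the bath is thermal. -/
def initialState (R : ResetProcess m b) (kT : ℝ) (σ : Matrix m m ℂ) : Matrix (m × b) (m × b) ℂ :=
  σ ⊗ₖ thermalState kT R.bathHamiltonian

/-- `ρ''_MB = U_MB (σ ⊗ ρ_B) U_MB†`. -/
def finalState (R : ResetProcess m b) (kT : ℝ) (σ : Matrix m m ℂ) : Matrix (m × b) (m × b) ℂ :=
  R.unitary * R.initialState kT σ * R.unitaryᴴ

/-- The process takes the memory from the state `σ` to the state `τ`. -/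
def Resets (R : ResetProcess m b) (kT : ℝ) (σ τ : Matrix m m ℂ) : Prop :=
  traceSnd (R.finalState kT σ) = τ

/-- `ΔE_R = tr[(H_M + H_B)(ρ''_MB - ρ'_MB)]`. -/
def cost (R : ResetProcess m b) (kT : ℝ) (HM σ : Matrix m m ℂ) : ℝ :=
  energy (HM ⊗ₖ (1 : Matrix b b ℂ) + (1 : Matrix m m ℂ) ⊗ₖ R.bathHamiltonian)
    (R.finalState kT σ - R.initialState kT σ)

end ResetProcess

end

end MeasurementCost

/-! With an optimal reset the memory energies cancel, and the bound becomes `S(ρ_S) - ∑ p_k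
S(ρ'_{S,k}) ≤ S(ρ'_M) - S(ρ_M)`. The evolved state `ω = U (ρ_S ⊗ ρ_M) U†` has entropy `S(ρ_S) +
S(ρ_M)`, so it suffices that `S(ω) ≤ ∑ p_k S(ρ'_{S,k}) + S(ρ'_M)`; this is
`Device.Implements.entropy_evolved_le`.

That inequality is one instance of the Gibbs variational principle `S(ω) ≤ -tr[ωK] + log tr[exp K]`,
with `K = ∑ log ρ'_{S,k} ⊗ Q_k + 1 ⊗ log ρ'_M`. Since `ρ'_M` is block diagonal for the `Q_k`, the
two summands commute and `exp K = ∑ ρ'_{S,k} ⊗ Q_k ρ'_M` has trace `∑ p_k = 1`, while the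
implementation property turns `-tr[ωK]` into the right-hand side. Singular states are handled by
`log (· + ε)` and the limit `ε → 0+`.

For a thermal bath, the same principle with `K = log τ ⊗ 1 - 1 ⊗ H_B / kT`, where `τ` is the
restored memory state, shows that no reset is cheaper than the optimal one
(`ResetProcess.neg_freeEnergy_sub_le_cost`). -/

namespace MeasurementCost

set_option linter.unusedSectionVars false

open Matrix Filter Topology


/-! ### Spectral calculus, the Gibbs variational principle and regularised logarithms. -/

section Spectral

variable {n : Type*} [Fintype n] [DecidableEq n]

theorem conjTranspose_mul_self_of_mem_unitaryGroup {V : Matrix n n ℂ}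
    (hV : V ∈ unitaryGroup n ℂ) : Vᴴ * V = 1 :=
  mem_unitaryGroup_iff'.1 hV

theorem mul_conjTranspose_self_of_mem_unitaryGroup {V : Matrix n n ℂ}
    (hV : V ∈ unitaryGroup n ℂ) : V * Vᴴ = 1 :=
  mem_unitaryGroup_iff.1 hV

theorem conjTranspose_mem_unitaryGroup {V : Matrix n n ℂ}
    (hV : V ∈ unitaryGroup n ℂ) : Vᴴ ∈ unitaryGroup n ℂ :=
  Unitary.star_mem hV

/-- The Hermitian matrix with eigenvalues `d` and orthonormal eigenvectors the columns of `V`. -/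
noncomputable def unitaryDiag (V : Matrix n n ℂ) (d : n → ℝ) : Matrix n n ℂ :=
  V * diagonal (fun i => (d i : ℂ)) * Vᴴ

theorem isHermitian_unitaryDiag (V : Matrix n n ℂ) (d : n → ℝ) :
    (unitaryDiag V d).IsHermitian := by
  have h : (diagonal (fun i => (d i : ℂ)))ᴴ = diagonal (fun i => (d i : ℂ)) := by
    rw [diagonal_conjTranspose]
    congr 1
    ext i
    simp
  simp only [unitaryDiag, IsHermitian, conjTranspose_mul, conjTranspose_conjTranspose, h,
    Matrix.mul_assoc]

theorem exists_unitaryDiag_cfc {A : Matrix n n ℂ} (hA : A.IsHermitian) :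
    ∃ V ∈ unitaryGroup n ℂ, A = unitaryDiag V hA.eigenvalues ∧
      ∀ f : ℝ → ℝ, cfc f A = unitaryDiag V (f ∘ hA.eigenvalues) := by
  refine ⟨hA.eigenvectorUnitary, hA.eigenvectorUnitary.2, ?_, fun f => ?_⟩
  · exact hA.spectral_theorem
  · exact hA.cfc_eq f

/-- Frees the functional calculus from the chosen eigenbasis. The unitary `Vᴴ * W` intertwines the
two diagonal matrices, so its entries vanish unless the corresponding eigenvalues agree; hence it
also intertwines their images under `f`. -/
theorem cfc_unitaryDiag {V : Matrix n n ℂ} (hV : V ∈ unitaryGroup n ℂ) (d : n → ℝ) (f : ℝ → ℝ) :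
    cfc f (unitaryDiag V d) = unitaryDiag V (f ∘ d) := by
  obtain ⟨W, hW, hA, hf⟩ := exists_unitaryDiag_cfc (isHermitian_unitaryDiag V d)
  rw [hf]
  set l := (isHermitian_unitaryDiag V d).eigenvalues
  have hV' := conjTranspose_mul_self_of_mem_unitaryGroup hV
  have hV'' := mul_conjTranspose_self_of_mem_unitaryGroup hV
  have hW' := conjTranspose_mul_self_of_mem_unitaryGroup hW
  have hW'' := mul_conjTranspose_self_of_mem_unitaryGroup hW
  have key : diagonal (fun i => (d i : ℂ)) * (Vᴴ * W) =
      Vᴴ * W * diagonal (fun i => (l i : ℂ)) := by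
    calc _ = (Vᴴ * V) * diagonal (fun i => (d i : ℂ)) * Vᴴ * W := by
          rw [hV', Matrix.one_mul, Matrix.mul_assoc]
      _ = Vᴴ * unitaryDiag V d * W := by simp only [unitaryDiag, Matrix.mul_assoc]
      _ = Vᴴ * W * diagonal (fun i => (l i : ℂ)) * (Wᴴ * W) := by
          rw [hA]; simp only [unitaryDiag, Matrix.mul_assoc]
      _ = _ := by rw [hW', Matrix.mul_one]
  have key' : diagonal (fun i => (f (d i) : ℂ)) * (Vᴴ * W) =
      Vᴴ * W * diagonal (fun i => (f (l i) : ℂ)) := by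
    ext i j
    have h := congrFun₂ key i j
    rw [diagonal_mul, mul_diagonal] at h ⊢
    by_cases hx : (Vᴴ * W) i j = 0
    · simp [hx]
    · have : (d i : ℂ) = l j := by
        rw [mul_comm] at h
        exact mul_left_cancel₀ hx h
      rw [Complex.ofReal_inj.1 this, mul_comm]
  calc unitaryDiag W (f ∘ l)
      = (V * Vᴴ) * W * diagonal (fun i => (f (l i) : ℂ)) * Wᴴ := by
        rw [hV'', Matrix.one_mul]; rfl
    _ = V * (Vᴴ * W * diagonal (fun i => (f (l i) : ℂ))) * Wᴴ := by
        simp only [Matrix.mul_assoc]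
    _ = V * diagonal (fun i => (f (d i) : ℂ)) * Vᴴ * (W * Wᴴ) := by
        rw [← key']; simp only [Matrix.mul_assoc]
    _ = unitaryDiag V (f ∘ d) := by rw [hW'', Matrix.mul_one]; rfl

theorem exp_unitaryDiag {V : Matrix n n ℂ} (hV : V ∈ unitaryGroup n ℂ) (d : n → ℝ) :
    NormedSpace.exp (unitaryDiag V d) = unitaryDiag V (Real.exp ∘ d) := by
  have hinv : V⁻¹ = Vᴴ := inv_eq_left_inv (conjTranspose_mul_self_of_mem_unitaryGroup hV)
  have hu : IsUnit V :=
    IsUnit.of_mul_eq_one _ (mul_conjTranspose_self_of_mem_unitaryGroup hV)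
  have h := Matrix.exp_conj V (diagonal (fun i => (d i : ℂ))) hu
  rw [hinv, exp_diagonal] at h
  rw [unitaryDiag, h, unitaryDiag]
  congr 3
  ext i
  rw [Pi.coe_exp]
  simp [← Complex.exp_eq_exp_ℂ]

theorem trace_unitaryDiag {V : Matrix n n ℂ} (hV : V ∈ unitaryGroup n ℂ) (d : n → ℝ) :
    (unitaryDiag V d).trace = ((∑ i, d i : ℝ) : ℂ) := by
  rw [unitaryDiag, Matrix.mul_assoc, trace_mul_comm, Matrix.mul_assoc,
    conjTranspose_mul_self_of_mem_unitaryGroup hV, Matrix.mul_one, trace_diagonal]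
  push_cast
  rfl

theorem unitaryDiag_mul {V : Matrix n n ℂ} (hV : V ∈ unitaryGroup n ℂ) (d e : n → ℝ) :
    unitaryDiag V d * unitaryDiag V e = unitaryDiag V (d * e) := by
  calc unitaryDiag V d * unitaryDiag V e
      = V * diagonal (fun i => (d i : ℂ)) * (Vᴴ * V) * diagonal (fun i => (e i : ℂ)) * Vᴴ := by
        simp only [unitaryDiag, Matrix.mul_assoc]
    _ = V * (diagonal (fun i => (d i : ℂ)) * diagonal (fun i => (e i : ℂ))) * Vᴴ := by
        rw [conjTranspose_mul_self_of_mem_unitaryGroup hV, Matrix.mul_one, Matrix.mul_assoc V]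
    _ = _ := by
        rw [diagonal_mul_diagonal, unitaryDiag]
        simp

theorem entropy_unitaryDiag {V : Matrix n n ℂ} (hV : V ∈ unitaryGroup n ℂ) (d : n → ℝ) :
    entropy (unitaryDiag V d) = ∑ i, Real.negMulLog (d i) := by
  rw [entropy, cfc_unitaryDiag hV, unitaryDiag_mul hV, trace_unitaryDiag hV, Complex.ofReal_re,
    ← Finset.sum_neg_distrib]
  simp [Real.negMulLog]

theorem trace_unitaryDiag_mul_unitaryDiag (V W : Matrix n n ℂ) (d e : n → ℝ) :
    (unitaryDiag V d * unitaryDiag W e).trace =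
      ((∑ i, ∑ j, d i * e j * Complex.normSq ((Vᴴ * W) i j) : ℝ) : ℂ) := by
  have h : (unitaryDiag V d * unitaryDiag W e).trace =
      (diagonal (fun i => (d i : ℂ)) * (Vᴴ * W) *
        (diagonal (fun i => (e i : ℂ)) * (Vᴴ * W)ᴴ)).trace := by
    simp only [unitaryDiag, conjTranspose_mul, conjTranspose_conjTranspose, Matrix.mul_assoc]
    rw [trace_mul_comm]
    simp only [Matrix.mul_assoc]
  rw [h, trace]
  push_cast
  refine Finset.sum_congr rfl fun i _ => ?_
  rw [diag_apply, mul_apply]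
  refine Finset.sum_congr rfl fun j _ => ?_
  rw [diagonal_mul, diagonal_mul, conjTranspose_apply, ← Complex.mul_conj]
  simp only [RCLike.star_def]
  ring

theorem sum_normSq_row {V : Matrix n n ℂ} (hV : V ∈ unitaryGroup n ℂ) (i : n) :
    ∑ j, Complex.normSq (V i j) = 1 := by
  have h := congrFun₂ (mul_conjTranspose_self_of_mem_unitaryGroup hV) i i
  rw [mul_apply, one_apply_eq] at h
  simp only [conjTranspose_apply, RCLike.star_def, Complex.mul_conj] at h
  exact_mod_cast h

theorem sum_normSq_col {V : Matrix n n ℂ} (hV : V ∈ unitaryGroup n ℂ) (j : n) :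
    ∑ i, Complex.normSq (V i j) = 1 := by
  have h := sum_normSq_row (conjTranspose_mem_unitaryGroup hV) j
  simpa [conjTranspose_apply] using h

/-- The tangent bound `1 + x ≤ exp x` at `x = k - log p`, multiplied by `p`; at `p = 0` only `exp k`
remains. -/
theorem mul_log_sub_mul_add_exp_sub_nonneg {p : ℝ} (hp : 0 ≤ p) (k : ℝ) :
    0 ≤ p * Real.log p - p * k + Real.exp k - p := by
  rcases hp.eq_or_lt with rfl | hp
  · simpa using (Real.exp_pos k).le
  · have h := Real.add_one_le_exp (k - Real.log p)
    rw [Real.exp_sub, Real.exp_log hp, le_div_iff₀ hp] at h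
    nlinarith

/-- The Gibbs variational principle. -/
theorem entropy_le_neg_trace_mul_add_log_trace_exp {ρ K : Matrix n n ℂ} (hρ : IsState ρ)
    (hK : K.IsHermitian) :
    entropy ρ ≤ -(ρ * K).trace.re + Real.log (NormedSpace.exp K).trace.re := by
  obtain ⟨V, hV, hρV, -⟩ := exists_unitaryDiag_cfc hρ.posSemidef.1
  obtain ⟨W, hW, hKW, -⟩ := exists_unitaryDiag_cfc hK
  have hp : ∀ i, 0 ≤ hρ.posSemidef.1.eigenvalues i := hρ.posSemidef.eigenvalues_nonneg
  set p := hρ.posSemidef.1.eigenvalues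
  set k := hK.eigenvalues
  have hp1 : ∑ i, p i = 1 := by
    have h := hρ.trace_eq_one
    rw [hρV, trace_unitaryDiag hV] at h
    exact_mod_cast h
  have hne : Nonempty n := by
    by_contra h
    rw [not_nonempty_iff] at h
    simp at hp1
  rw [hρV, entropy_unitaryDiag hV, hKW, trace_unitaryDiag_mul_unitaryDiag, exp_unitaryDiag hW,
    trace_unitaryDiag hW, Complex.ofReal_re, Complex.ofReal_re]
  set Z := ∑ i, (Real.exp ∘ k) i
  have hZ : 0 < Z := Finset.sum_pos (fun i _ => Real.exp_pos _) Finset.univ_nonempty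
  have hX : Vᴴ * W ∈ unitaryGroup n ℂ := mul_mem (conjTranspose_mem_unitaryGroup hV) hW
  set c : n → n → ℝ := fun i j => Complex.normSq ((Vᴴ * W) i j)
  have hrow : ∀ i, ∑ j, c i j = 1 := sum_normSq_row hX
  have hcol : ∀ j, ∑ i, c i j = 1 := sum_normSq_col hX
  -- The scalar bound is averaged with the doubly stochastic overlaps `c`. Shifting `k` by `log Z`
  -- normalises the exponential term to `1`, which cancels `∑ p = 1`.
  have hnonneg : 0 ≤ ∑ i, ∑ j, c i j * (p i * Real.log (p i) - p i * (k j - Real.log Z) +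
      Real.exp (k j - Real.log Z) - p i) :=
    Finset.sum_nonneg fun i _ => Finset.sum_nonneg fun j _ =>
      mul_nonneg (Complex.normSq_nonneg _) (mul_log_sub_mul_add_exp_sub_nonneg (hp i) _)
  have h1 : ∑ i, ∑ j, c i j * (p i * Real.log (p i)) = -∑ i, Real.negMulLog (p i) := by
    simp_rw [← Finset.sum_mul, hrow, one_mul, Real.negMulLog, neg_mul, Finset.sum_neg_distrib,
      neg_neg]
  have h2 : ∑ i, ∑ j, c i j * (p i * Real.log Z) = Real.log Z := by
    simp_rw [← Finset.sum_mul, hrow, one_mul, ← Finset.sum_mul, hp1, one_mul]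
  have h3 : ∑ i, ∑ j, c i j * Real.exp (k j - Real.log Z) = 1 := by
    rw [Finset.sum_comm]
    simp_rw [← Finset.sum_mul, hcol, one_mul, Real.exp_sub, Real.exp_log hZ, ← Finset.sum_div]
    exact div_self hZ.ne'
  have h4 : ∑ i, ∑ j, c i j * p i = 1 := by
    simp_rw [← Finset.sum_mul, hrow, one_mul, hp1]
  have h5 : ∑ i, ∑ j, c i j * (p i * Real.log (p i) - p i * (k j - Real.log Z) +
      Real.exp (k j - Real.log Z) - p i) =
      ∑ i, ∑ j, c i j * (p i * Real.log (p i)) - ∑ i, ∑ j, p i * k j * c i j +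
      ∑ i, ∑ j, c i j * (p i * Real.log Z) + ∑ i, ∑ j, c i j * Real.exp (k j - Real.log Z) -
      ∑ i, ∑ j, c i j * p i := by
    simp only [← Finset.sum_add_distrib, ← Finset.sum_sub_distrib]
    refine Finset.sum_congr rfl fun i _ => Finset.sum_congr rfl fun j _ => ?_
    ring
  rw [h5, h1, h2, h3, h4] at hnonneg
  linarith

theorem entropy_unitary_conj {U : Matrix n n ℂ} (hU : U ∈ unitaryGroup n ℂ) {ρ : Matrix n n ℂ}
    (hρ : ρ.IsHermitian) : entropy (U * ρ * Uᴴ) = entropy ρ := by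
  obtain ⟨V, hV, hρV, -⟩ := exists_unitaryDiag_cfc hρ
  rw [hρV, entropy_unitaryDiag hV, ← entropy_unitaryDiag (mul_mem hU hV)]
  simp only [unitaryDiag, conjTranspose_mul, Matrix.mul_assoc]

theorem entropy_kronecker {m : Type*} [Fintype m] [DecidableEq m] {ρ : Matrix n n ℂ}
    {σ : Matrix m m ℂ} (hρ : IsState ρ) (hσ : IsState σ) :
    entropy (ρ ⊗ₖ σ) = entropy ρ + entropy σ := by
  obtain ⟨V, hV, hρV, -⟩ := exists_unitaryDiag_cfc hρ.posSemidef.1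
  obtain ⟨W, hW, hσW, -⟩ := exists_unitaryDiag_cfc hσ.posSemidef.1
  set p := hρ.posSemidef.1.eigenvalues
  set q := hσ.posSemidef.1.eigenvalues
  have hp1 : ∑ i, p i = 1 := by
    have h := hρ.trace_eq_one
    rw [hρV, trace_unitaryDiag hV] at h
    exact_mod_cast h
  have hq1 : ∑ i, q i = 1 := by
    have h := hσ.trace_eq_one
    rw [hσW, trace_unitaryDiag hW] at h
    exact_mod_cast h
  have hVW : V ⊗ₖ W ∈ unitaryGroup (n × m) ℂ := kronecker_mem_unitary hV hW
  have h : ρ ⊗ₖ σ = unitaryDiag (V ⊗ₖ W) (fun i => p i.1 * q i.2) := by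
    rw [hρV, hσW]
    simp only [unitaryDiag, conjTranspose_kronecker, mul_kronecker_mul,
      Complex.ofReal_mul, diagonal_kronecker_diagonal]
  rw [h, entropy_unitaryDiag hVW, hρV, hσW, entropy_unitaryDiag hV, entropy_unitaryDiag hW,
    Fintype.sum_prod_type]
  simp_rw [Real.negMulLog_mul, Finset.sum_add_distrib, ← Finset.sum_mul, ← Finset.mul_sum]
  rw [hq1, ← Finset.sum_mul, hp1]
  ring

/-- `log (ρ + ε)`. -/
noncomputable def shiftedLog (ε : ℝ) (ρ : Matrix n n ℂ) : Matrix n n ℂ :=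
  cfc (fun x => Real.log (x + ε)) ρ

theorem isHermitian_shiftedLog (ε : ℝ) (ρ : Matrix n n ℂ) : (shiftedLog ε ρ).IsHermitian :=
  cfc_predicate _ ρ

/-- The shift makes every eigenvalue positive, so `exp` inverts `log` despite the convention
`Real.log 0 = 0`. -/
theorem exp_shiftedLog {ρ : Matrix n n ℂ} (hρ : ρ.PosSemidef) {ε : ℝ} (hε : 0 < ε) :
    NormedSpace.exp (shiftedLog ε ρ) = ρ + (ε : ℂ) • 1 := by
  obtain ⟨V, hV, hρV, hf⟩ := exists_unitaryDiag_cfc hρ.1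
  have hl := hρ.eigenvalues_nonneg
  rw [shiftedLog, hf, exp_unitaryDiag hV]
  generalize hρ.1.eigenvalues = l at hl hρV
  have h : (1 : Matrix n n ℂ) = V * Vᴴ := (mul_conjTranspose_self_of_mem_unitaryGroup hV).symm
  have h2 : (ε : ℂ) • (1 : Matrix n n ℂ) = V * diagonal (fun _ => (ε : ℂ)) * Vᴴ := by
    rw [← smul_one_eq_diagonal]
    simp [← h]
  rw [h2, hρV, unitaryDiag, unitaryDiag, ← Matrix.add_mul, ← Matrix.mul_add, diagonal_add]
  congr 3
  ext i
  rw [Function.comp_apply, Function.comp_apply,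
    Real.exp_log (add_pos_of_nonneg_of_pos (hl i) hε)]
  push_cast
  rfl

theorem trace_mul_cfc {ρ : Matrix n n ℂ} (hρ : ρ.IsHermitian) (f : ℝ → ℝ) :
    (ρ * cfc f ρ).trace.re = ∑ i, hρ.eigenvalues i * f (hρ.eigenvalues i) := by
  obtain ⟨V, hV, hρV, hf⟩ := exists_unitaryDiag_cfc hρ
  rw [hf]
  nth_rw 1 [hρV]
  rw [unitaryDiag_mul hV, trace_unitaryDiag hV, Complex.ofReal_re]
  rfl

/-- A zero eigenvalue contributes `0 * log ε = 0` for every `ε`; at the others `log` is continuous.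
-/
theorem tendsto_trace_mul_shiftedLog {ρ : Matrix n n ℂ} (hρ : ρ.IsHermitian) :
    Tendsto (fun ε => (ρ * shiftedLog ε ρ).trace.re) (𝓝[>] 0) (𝓝 (-entropy ρ)) := by
  simp_rw [entropy, neg_neg, shiftedLog, trace_mul_cfc hρ]
  refine tendsto_finsetSum _ fun i _ => ?_
  rcases eq_or_ne (hρ.eigenvalues i) 0 with h | h
  · simp [h]
  · refine Tendsto.const_mul _ ?_
    have : ContinuousAt (fun ε => Real.log (hρ.eigenvalues i + ε)) 0 :=
      ContinuousAt.log (by fun_prop) (by simpa using h)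
    have h2 := this.tendsto
    rw [add_zero] at h2
    exact h2.mono_left nhdsWithin_le_nhds

end Spectral


/-! ### Partial traces and states on tensor products. -/

section PartialTrace

variable {a b : Type*} [Fintype a] [DecidableEq a] [Fintype b] [DecidableEq b]

theorem trace_traceFst (X : Matrix (a × b) (a × b) ℂ) : (traceFst X).trace = X.trace := by
  simp only [trace, traceFst, diag_apply, of_apply, Fintype.sum_prod_type]
  exact Finset.sum_comm

theorem trace_traceSnd (X : Matrix (a × b) (a × b) ℂ) : (traceSnd X).trace = X.trace := by
  simp only [trace, traceSnd, diag_apply, of_apply, Fintype.sum_prod_type]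

theorem traceFst_sum {κ : Type*} (t : Finset κ) (X : κ → Matrix (a × b) (a × b) ℂ) :
    traceFst (∑ k ∈ t, X k) = ∑ k ∈ t, traceFst (X k) := by
  ext i j
  simp only [traceFst, of_apply, Matrix.sum_apply]
  exact Finset.sum_comm

theorem traceSnd_mul_kronecker_one (X : Matrix (a × b) (a × b) ℂ) (A : Matrix a a ℂ) :
    traceSnd (X * A ⊗ₖ 1) = traceSnd X * A := by
  ext i j
  simp only [traceSnd, of_apply, mul_apply, kroneckerMap_apply, Fintype.sum_prod_type, one_apply,
    mul_ite, mul_one, mul_zero, Finset.sum_ite_eq', Finset.mem_univ, if_true, Finset.sum_mul]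
  exact Finset.sum_comm

theorem traceFst_mul_one_kronecker (X : Matrix (a × b) (a × b) ℂ) (B : Matrix b b ℂ) :
    traceFst (X * 1 ⊗ₖ B) = traceFst X * B := by
  ext i j
  simp only [traceFst, of_apply, mul_apply, kroneckerMap_apply, Fintype.sum_prod_type,
    Finset.sum_mul]
  rw [Finset.sum_comm (s := (Finset.univ : Finset b))]
  refine Finset.sum_congr rfl fun x _ => ?_
  rw [Finset.sum_eq_single x (fun y _ hy => by simp [one_apply_ne hy]) (by simp)]
  simp

theorem traceFst_one_kronecker_mul (X : Matrix (a × b) (a × b) ℂ) (B : Matrix b b ℂ) :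
    traceFst (1 ⊗ₖ B * X) = B * traceFst X := by
  ext i j
  simp only [traceFst, of_apply, mul_apply, kroneckerMap_apply, Fintype.sum_prod_type,
    Finset.mul_sum]
  rw [Finset.sum_comm (s := (Finset.univ : Finset b))]
  refine Finset.sum_congr rfl fun x _ => ?_
  rw [Finset.sum_eq_single x (fun y _ hy => by simp [one_apply_ne hy.symm]) (by simp)]
  simp

theorem trace_mul_kronecker_one (X : Matrix (a × b) (a × b) ℂ) (A : Matrix a a ℂ) :
    (X * A ⊗ₖ 1).trace = (traceSnd X * A).trace := by
  rw [← traceSnd_mul_kronecker_one, trace_traceSnd]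

theorem trace_mul_one_kronecker (X : Matrix (a × b) (a × b) ℂ) (B : Matrix b b ℂ) :
    (X * 1 ⊗ₖ B).trace = (traceFst X * B).trace := by
  rw [← traceFst_mul_one_kronecker, trace_traceFst]

theorem traceFst_kronecker (A : Matrix a a ℂ) (B : Matrix b b ℂ) :
    traceFst (A ⊗ₖ B) = A.trace • B := by
  ext i j
  simp [traceFst, trace, Finset.sum_mul]

theorem traceSnd_kronecker (A : Matrix a a ℂ) (B : Matrix b b ℂ) :
    traceSnd (A ⊗ₖ B) = B.trace • A := by
  ext i j
  simp [traceSnd, trace, Finset.mul_sum, mul_comm]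

theorem posSemidef_traceFst {X : Matrix (a × b) (a × b) ℂ} (hX : X.PosSemidef) :
    (traceFst X).PosSemidef := by
  have h : traceFst X = ∑ x, X.submatrix (fun i => (x, i)) (fun i => (x, i)) := by
    ext i j
    simp [traceFst, Matrix.sum_apply]
  rw [h]
  exact posSemidef_sum _ fun x _ => hX.submatrix _

theorem IsState.kronecker {ρ : Matrix a a ℂ} {σ : Matrix b b ℂ} (hρ : IsState ρ)
    (hσ : IsState σ) : IsState (ρ ⊗ₖ σ) :=
  ⟨hρ.posSemidef.kronecker hσ.posSemidef, by
    rw [trace_kronecker, hρ.trace_eq_one, hσ.trace_eq_one, one_mul]⟩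

theorem IsState.unitary_conj {U ρ : Matrix a a ℂ} (hU : U ∈ unitaryGroup a ℂ) (hρ : IsState ρ) :
    IsState (U * ρ * Uᴴ) :=
  ⟨hρ.posSemidef.mul_mul_conjTranspose_same U, by
    rw [Matrix.mul_assoc, trace_mul_comm, Matrix.mul_assoc,
      conjTranspose_mul_self_of_mem_unitaryGroup hU, Matrix.mul_one, hρ.trace_eq_one]⟩

end PartialTrace

/-! ### Exponentials of block operators, and orthogonality of projections. -/

section Exponential

variable {a b κ : Type*} [Fintype a] [DecidableEq a] [Fintype b] [DecidableEq b] [Fintype κ]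

open scoped Norms.Operator in
theorem exp_one_kronecker (B : Matrix b b ℂ) :
    NormedSpace.exp ((1 : Matrix a a ℂ) ⊗ₖ B) = (1 : Matrix a a ℂ) ⊗ₖ NormedSpace.exp B := by
  let φ : Matrix b b ℂ →+* Matrix (a × b) (a × b) ℂ :=
    { toFun := fun B => (1 : Matrix a a ℂ) ⊗ₖ B
      map_one' := one_kronecker_one
      map_zero' := kronecker_zero _
      map_add' := kronecker_add _
      map_mul' := fun X Y => by rw [← mul_kronecker_mul, Matrix.one_mul] }
  have hφ : Continuous φ := by
    refine continuous_matrix fun i j => ?_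
    change Continuous fun B : Matrix b b ℂ => (1 : Matrix a a ℂ) i.1 j.1 * B i.2 j.2
    fun_prop
  exact (NormedSpace.map_exp φ hφ B).symm

open scoped Norms.Operator in
-- The map `A ↦ ∑ k, A k ⊗ Q k` is a continuous ring homomorphism from the product algebra: unital
-- because the `Q k` sum to one, multiplicative because they are orthogonal idempotents. Such maps
-- commute with `exp`, which on the product acts componentwise.
theorem exp_sum_kronecker (A : κ → Matrix a a ℂ) {Q : κ → Matrix b b ℂ}
    (hQ : ∀ k, Q k * Q k = Q k) (hQ' : Pairwise fun j k => Q j * Q k = 0) (hQ1 : ∑ k, Q k = 1) :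
    NormedSpace.exp (∑ k, A k ⊗ₖ Q k) = ∑ k, NormedSpace.exp (A k) ⊗ₖ Q k := by
  classical
  let φ : (κ → Matrix a a ℂ) →+* Matrix (a × b) (a × b) ℂ :=
    { toFun := fun A => ∑ k, A k ⊗ₖ Q k
      map_one' := by
        simp only [Pi.one_apply]
        ext i j
        have h := congrFun₂ hQ1 i.2 j.2
        rw [Matrix.sum_apply] at h
        simp only [Matrix.sum_apply, kroneckerMap_apply, ← Finset.mul_sum, h]
        rw [← one_kronecker_one, kroneckerMap_apply]
      map_zero' := by simp
      map_add' := fun X Y => by simp [add_kronecker, Finset.sum_add_distrib]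
      map_mul' := fun X Y => by
        rw [Finset.sum_mul_sum]
        refine Finset.sum_congr rfl fun k _ => ?_
        rw [Finset.sum_eq_single k]
        · rw [← mul_kronecker_mul, hQ, Pi.mul_apply]
        · intro j _ hj
          rw [← mul_kronecker_mul, hQ' hj.symm, kronecker_zero]
        · simp }
  have hφ : Continuous φ := by
    refine continuous_matrix fun i j => ?_
    change Continuous fun A : κ → Matrix a a ℂ => (∑ k, A k ⊗ₖ Q k) i j
    simp only [Matrix.sum_apply, kroneckerMap_apply]
    fun_prop
  have h := (NormedSpace.map_exp φ hφ A).symm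
  change NormedSpace.exp (∑ k, A k ⊗ₖ Q k) = ∑ k, NormedSpace.exp A k ⊗ₖ Q k at h
  rw [h]
  exact Finset.sum_congr rfl fun k _ => congrArg (· ⊗ₖ Q k)
    (NormedSpace.map_exp (Pi.evalRingHom (fun _ : κ => Matrix a a ℂ) k) (continuous_apply k) A)

theorem exp_kronecker_one (A : Matrix a a ℂ) :
    NormedSpace.exp (A ⊗ₖ (1 : Matrix b b ℂ)) = NormedSpace.exp A ⊗ₖ (1 : Matrix b b ℂ) := by
  have h := exp_sum_kronecker (κ := Unit) (fun _ => A) (Q := fun _ => (1 : Matrix b b ℂ))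
    (fun _ => Matrix.one_mul _) (fun i j h => absurd (Subsingleton.elim i j) h) (by simp)
  simpa using h

/-- Projections that sum to one are mutually orthogonal. -/
theorem mul_eq_zero_of_isStarProjection_of_sum_eq_one {Q : κ → Matrix b b ℂ}
    (hQ : ∀ k, IsStarProjection (Q k)) (hQ1 : ∑ k, Q k = 1) :
    Pairwise fun j k => Q j * Q k = 0 := by
  classical
  intro k j hkj
  have hsq : ∀ k, Q k * Q k = Q k := fun k => (hQ k).isIdempotentElem
  have hadj : ∀ k, (Q k)ᴴ = Q k := fun k => (hQ k).isSelfAdjoint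
  -- Each compression is positive semidefinite, and those with `k ≠ j` sum to zero because the full
  -- sum is already `Q j`. So their traces vanish, which forces `Q k * Q j = 0`.
  have hterm : ∀ k, Q j * Q k * Q j = (Q k * Q j)ᴴ * (Q k * Q j) := by
    intro k
    rw [conjTranspose_mul, hadj, hadj, Matrix.mul_assoc (Q j) (Q k) (Q k * Q j),
      ← Matrix.mul_assoc (Q k) (Q k), hsq, Matrix.mul_assoc]
  have h0 : ∑ k ∈ Finset.univ.erase j, Q j * Q k * Q j = 0 := by
    have h : ∑ k, Q j * Q k * Q j = Q j := by
      rw [← Finset.sum_mul, ← Finset.mul_sum, hQ1, Matrix.mul_one, hsq]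
    rw [← Finset.add_sum_erase _ _ (Finset.mem_univ j), hsq, hsq] at h
    simpa using h
  have htr : ∑ k ∈ Finset.univ.erase j, (Q j * Q k * Q j).trace = 0 := by
    rw [← trace_sum, h0, trace_zero]
  have hnn : ∀ k ∈ Finset.univ.erase j, 0 ≤ (Q j * Q k * Q j).trace := fun k _ => by
    rw [hterm]
    exact (posSemidef_conjTranspose_mul_self _).trace_nonneg
  have := (Finset.sum_eq_zero_iff_of_nonneg hnn).1 htr k (by simp [hkj])
  rw [hterm] at this
  exact trace_conjTranspose_mul_self_eq_zero_iff.1 this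

end Exponential


/-! ### The measurement step: entropy decrease of the system against entropy gain of the memory. -/

section Measurement

variable {s m κ : Type*} {ι : κ → Type*} [Fintype s] [DecidableEq s] [Fintype m] [DecidableEq m]
  [Fintype κ] [∀ k, Fintype (ι k)]

theorem Measurement.posSemidef_branch (M : Measurement s κ ι) {ρ : Matrix s s ℂ}
    (hρ : ρ.PosSemidef) (k : κ) : (M.branch ρ k).PosSemidef :=
  posSemidef_sum _ fun _ _ => hρ.mul_mul_conjTranspose_same _

theorem Measurement.trace_branch (M : Measurement s κ ι) {ρ : Matrix s s ℂ}
    (hρ : ρ.PosSemidef) (k : κ) : (M.branch ρ k).trace = (M.prob ρ k : ℂ) := by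
  have h : M.prob ρ k = (M.branch ρ k).trace.re := by
    rw [Measurement.prob, Measurement.branch, trace_sum]
  rw [h]
  have h2 := (Complex.nonneg_iff.1 (M.posSemidef_branch hρ k).trace_nonneg).2
  exact Complex.ext rfl (by simpa using h2.symm)

theorem Measurement.prob_nonneg (M : Measurement s κ ι) {ρ : Matrix s s ℂ}
    (hρ : ρ.PosSemidef) (k : κ) : 0 ≤ M.prob ρ k := by
  have h := (M.posSemidef_branch hρ k).trace_nonneg
  rw [M.trace_branch hρ] at h
  exact_mod_cast h

/-- For probability zero the branch is positive semidefinite with zero trace, hence zero, so the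
identity survives the convention `0⁻¹ = 0`. -/
theorem Measurement.prob_smul_post (M : Measurement s κ ι) {ρ : Matrix s s ℂ}
    (hρ : ρ.PosSemidef) (k : κ) : (M.prob ρ k : ℂ) • M.post ρ k = M.branch ρ k := by
  rw [Measurement.post, smul_smul]
  rcases eq_or_ne (M.prob ρ k) 0 with h | h
  · have h0 : M.branch ρ k = 0 := by
      rw [← (M.posSemidef_branch hρ k).trace_eq_zero_iff, M.trace_branch hρ, h, Complex.ofReal_zero]
    rw [h0, smul_zero]
  · rw [← Complex.ofReal_mul, mul_inv_cancel₀ h, Complex.ofReal_one, one_smul]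

theorem Measurement.posSemidef_post (M : Measurement s κ ι) {ρ : Matrix s s ℂ}
    (hρ : ρ.PosSemidef) (k : κ) : (M.post ρ k).PosSemidef := by
  refine (M.posSemidef_branch hρ k).smul ?_
  exact_mod_cast inv_nonneg.2 (M.prob_nonneg hρ k)

namespace Device

variable (D : Device s m κ)

theorem proj_mul_self (k : κ) : D.proj k * D.proj k = D.proj k :=
  (D.proj_isStarProjection k).isIdempotentElem

theorem proj_mul_proj {j k : κ} (h : j ≠ k) : D.proj j * D.proj k = 0 :=
  mul_eq_zero_of_isStarProjection_of_sum_eq_one D.proj_isStarProjection D.proj_sum h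

theorem isHermitian_proj (k : κ) : (D.proj k).IsHermitian :=
  (D.proj_isStarProjection k).isSelfAdjoint

theorem isState_evolved {ρ : Matrix s s ℂ} (hρ : IsState ρ) : IsState (D.evolved ρ) :=
  (hρ.kronecker D.memory_isState).unitary_conj D.unitary_mem

theorem entropy_evolved {ρ : Matrix s s ℂ} (hρ : IsState ρ) :
    entropy (D.evolved ρ) = entropy ρ + entropy D.memory := by
  rw [evolved, entropy_unitary_conj D.unitary_mem (hρ.kronecker D.memory_isState).posSemidef.1,
    entropy_kronecker hρ D.memory_isState]

theorem finalMemory_eq_sum (ρ : Matrix s s ℂ) :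
    D.finalMemory ρ = ∑ k, D.proj k * traceFst (D.evolved ρ) * D.proj k := by
  simp_rw [finalMemory, finalState, traceFst_sum, traceFst_mul_one_kronecker,
    traceFst_one_kronecker_mul]

theorem proj_mul_finalMemory (ρ : Matrix s s ℂ) (k : κ) :
    D.proj k * D.finalMemory ρ = D.proj k * traceFst (D.evolved ρ) * D.proj k := by
  rw [finalMemory_eq_sum, Finset.mul_sum, Finset.sum_eq_single k]
  · rw [← Matrix.mul_assoc, ← Matrix.mul_assoc, proj_mul_self]
  · intro j _ hj
    rw [← Matrix.mul_assoc, ← Matrix.mul_assoc, D.proj_mul_proj hj.symm, Matrix.zero_mul,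
      Matrix.zero_mul]
  · simp

theorem finalMemory_mul_proj (ρ : Matrix s s ℂ) (k : κ) :
    D.finalMemory ρ * D.proj k = D.proj k * traceFst (D.evolved ρ) * D.proj k := by
  rw [finalMemory_eq_sum, Finset.sum_mul, Finset.sum_eq_single k]
  · rw [Matrix.mul_assoc, proj_mul_self]
  · intro j _ hj
    rw [Matrix.mul_assoc, D.proj_mul_proj hj, Matrix.mul_zero]
  · simp

/-- The projections leave the memory block diagonal: either product is its `k`-th block. -/
theorem commute_finalMemory_proj (ρ : Matrix s s ℂ) (k : κ) :
    Commute (D.finalMemory ρ) (D.proj k) :=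
  (D.finalMemory_mul_proj ρ k).trans (D.proj_mul_finalMemory ρ k).symm

theorem trace_proj_mul_finalMemory (ρ : Matrix s s ℂ) (k : κ) :
    (D.proj k * D.finalMemory ρ).trace = (D.proj k * traceFst (D.evolved ρ)).trace := by
  rw [proj_mul_finalMemory, trace_mul_comm, ← Matrix.mul_assoc, proj_mul_self]

theorem posSemidef_finalMemory {ρ : Matrix s s ℂ} (hρ : IsState ρ) :
    (D.finalMemory ρ).PosSemidef := by
  rw [finalMemory_eq_sum]
  refine posSemidef_sum _ fun k _ => ?_
  have h := (posSemidef_traceFst (D.isState_evolved hρ).posSemidef).mul_mul_conjTranspose_same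
    (D.proj k)
  rwa [D.isHermitian_proj k] at h

theorem isState_finalMemory {ρ : Matrix s s ℂ} (hρ : IsState ρ) : IsState (D.finalMemory ρ) := by
  refine ⟨D.posSemidef_finalMemory hρ, ?_⟩
  calc (D.finalMemory ρ).trace = ∑ k, (D.proj k * D.finalMemory ρ).trace := by
        rw [← trace_sum, ← Finset.sum_mul, D.proj_sum, Matrix.one_mul]
    _ = (traceFst (D.evolved ρ)).trace := by
        simp_rw [trace_proj_mul_finalMemory]
        rw [← trace_sum, ← Finset.sum_mul, D.proj_sum, Matrix.one_mul]
    _ = 1 := by rw [trace_traceFst, (D.isState_evolved hρ).trace_eq_one]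

theorem commute_shiftedLog_proj (ε : ℝ) (ρ : Matrix s s ℂ) (k : κ) :
    Commute (shiftedLog ε (D.finalMemory ρ)) (D.proj k) :=
  (D.commute_finalMemory_proj ρ k).cfc_real _

/-- Observables commuting with every `Q_k` cannot distinguish the memory marginal before the
projections from the one after. -/
theorem trace_traceFst_evolved_mul {ρ : Matrix s s ℂ} {B : Matrix m m ℂ}
    (hB : ∀ k, Commute B (D.proj k)) :
    (traceFst (D.evolved ρ) * B).trace = (D.finalMemory ρ * B).trace := by
  rw [finalMemory_eq_sum, Finset.sum_mul, trace_sum]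
  have h : ∀ k, (D.proj k * traceFst (D.evolved ρ) * D.proj k * B).trace =
      (traceFst (D.evolved ρ) * B * D.proj k).trace := by
    intro k
    rw [Matrix.mul_assoc, trace_mul_comm, ← (hB k).eq, Matrix.mul_assoc B,
      ← Matrix.mul_assoc (D.proj k) (D.proj k), proj_mul_self, ← Matrix.mul_assoc, trace_mul_comm,
      ← Matrix.mul_assoc]
  simp_rw [h]
  rw [← trace_sum, ← Finset.mul_sum, D.proj_sum, Matrix.mul_one]

variable {D} {M : Measurement s κ ι}

theorem Implements.trace_proj_mul_finalMemory (hD : D.Implements M) {ρ : Matrix s s ℂ}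
    (hρ : IsState ρ) (k : κ) : (D.proj k * D.finalMemory ρ).trace = (M.prob ρ k : ℂ) := by
  rw [D.trace_proj_mul_finalMemory, ← traceFst_one_kronecker_mul, trace_traceFst, ← trace_traceSnd,
    hD ρ hρ k, M.trace_branch hρ.posSemidef]

theorem Implements.sum_prob (hD : D.Implements M) {ρ : Matrix s s ℂ} (hρ : IsState ρ) :
    ∑ k, M.prob ρ k = 1 := by
  have h : ∑ k, (M.prob ρ k : ℂ) = 1 := by
    simp_rw [← hD.trace_proj_mul_finalMemory hρ]
    rw [← trace_sum, ← Finset.sum_mul, D.proj_sum, Matrix.one_mul,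
      (D.isState_finalMemory hρ).trace_eq_one]
  exact_mod_cast h

/-- Splitting off `1 ⊗ Q_k` and cycling it to the left of the state produces exactly the operator in
the implementation condition. -/
theorem Implements.trace_evolved_mul_kronecker_proj (hD : D.Implements M) {ρ : Matrix s s ℂ}
    (hρ : IsState ρ) (A : Matrix s s ℂ) (k : κ) :
    (D.evolved ρ * A ⊗ₖ D.proj k).trace = (M.prob ρ k : ℂ) * (M.post ρ k * A).trace := by
  have h : A ⊗ₖ D.proj k = A ⊗ₖ (1 : Matrix m m ℂ) * (1 : Matrix s s ℂ) ⊗ₖ D.proj k := by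
    rw [← mul_kronecker_mul, Matrix.mul_one, Matrix.one_mul]
  rw [h, ← Matrix.mul_assoc, trace_mul_comm, ← Matrix.mul_assoc, trace_mul_kronecker_one,
    hD ρ hρ k, ← M.prob_smul_post hρ.posSemidef, Matrix.smul_mul, trace_smul, smul_eq_mul]

/-- `∑ k, log (ρ'_{S,k} + ε) ⊗ Q_k + 1 ⊗ log (ρ'_M + ε)`. -/
noncomputable def comparisonGenerator (D : Device s m κ) (M : Measurement s κ ι)
    (ρ : Matrix s s ℂ) (ε : ℝ) : Matrix (s × m) (s × m) ℂ :=
  ∑ k, shiftedLog ε (M.post ρ k) ⊗ₖ D.proj k +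
    (1 : Matrix s s ℂ) ⊗ₖ shiftedLog ε (D.finalMemory ρ)

theorem isHermitian_comparisonGenerator (ρ : Matrix s s ℂ) (ε : ℝ) :
    (comparisonGenerator D M ρ ε).IsHermitian := by
  rw [comparisonGenerator, IsHermitian, conjTranspose_add, conjTranspose_sum,
    conjTranspose_kronecker, conjTranspose_one, isHermitian_shiftedLog]
  simp_rw [conjTranspose_kronecker, (isHermitian_shiftedLog ε _).eq, (D.isHermitian_proj _).eq]

theorem Implements.trace_evolved_mul_comparisonGenerator (hD : D.Implements M)
    {ρ : Matrix s s ℂ} (hρ : IsState ρ) (ε : ℝ) :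
    (D.evolved ρ * comparisonGenerator D M ρ ε).trace.re =
      ∑ k, M.prob ρ k * (M.post ρ k * shiftedLog ε (M.post ρ k)).trace.re +
        (D.finalMemory ρ * shiftedLog ε (D.finalMemory ρ)).trace.re := by
  rw [comparisonGenerator, Matrix.mul_add, trace_add, Complex.add_re, Finset.mul_sum, trace_sum,
    trace_mul_one_kronecker, D.trace_traceFst_evolved_mul (D.commute_shiftedLog_proj ε ρ),
    Complex.re_sum]
  simp_rw [hD.trace_evolved_mul_kronecker_proj hρ, Complex.re_ofReal_mul]

theorem trace_exp_comparisonGenerator {ρ : Matrix s s ℂ} (hρ : IsState ρ) {ε : ℝ} (hε : 0 < ε) :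
    (NormedSpace.exp (comparisonGenerator D M ρ ε)).trace =
      ∑ k, (M.post ρ k + (ε : ℂ) • 1).trace *
        (D.proj k * (D.finalMemory ρ + (ε : ℂ) • 1)).trace := by
  have hcomm : Commute (∑ k, shiftedLog ε (M.post ρ k) ⊗ₖ D.proj k)
      ((1 : Matrix s s ℂ) ⊗ₖ shiftedLog ε (D.finalMemory ρ)) := by
    refine Commute.sum_left _ _ _ fun k _ => ?_
    rw [Commute, SemiconjBy, ← mul_kronecker_mul, ← mul_kronecker_mul, Matrix.mul_one,
      Matrix.one_mul, (D.commute_shiftedLog_proj ε ρ k).eq]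
  rw [comparisonGenerator, exp_add_of_commute _ _ hcomm,
    exp_sum_kronecker _ D.proj_mul_self (fun _ _ => D.proj_mul_proj) D.proj_sum,
    exp_one_kronecker, exp_shiftedLog (D.posSemidef_finalMemory hρ) hε, Finset.sum_mul, trace_sum]
  refine Finset.sum_congr rfl fun k _ => ?_
  rw [exp_shiftedLog (M.posSemidef_post hρ.posSemidef k) hε, ← mul_kronecker_mul, Matrix.mul_one,
    trace_kronecker]

theorem Implements.tendsto_trace_exp_comparisonGenerator (hD : D.Implements M)
    {ρ : Matrix s s ℂ} (hρ : IsState ρ) :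
    Tendsto (fun ε => (NormedSpace.exp (comparisonGenerator D M ρ ε)).trace.re)
      (𝓝[>] 0) (𝓝 1) := by
  have h1 : Continuous fun ε : ℝ => (∑ k, (M.post ρ k + (ε : ℂ) • 1).trace *
      (D.proj k * (D.finalMemory ρ + (ε : ℂ) • 1)).trace).re := by
    simp only [Matrix.mul_add, trace_add, trace_smul, Matrix.mul_smul, smul_eq_mul]
    fun_prop
  have h2 : (∑ k, (M.post ρ k + ((0 : ℝ) : ℂ) • 1).trace *
      (D.proj k * (D.finalMemory ρ + ((0 : ℝ) : ℂ) • 1)).trace).re = 1 := by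
    simp only [Complex.ofReal_zero, zero_smul, add_zero, hD.trace_proj_mul_finalMemory hρ]
    -- `post` has trace one only when the probability is nonzero, but this product is right in
    -- either case.
    have h : ∀ k, (M.post ρ k).trace * (M.prob ρ k : ℂ) = (M.prob ρ k : ℂ) := fun k => by
      rw [mul_comm, ← smul_eq_mul, ← trace_smul, M.prob_smul_post hρ.posSemidef,
        M.trace_branch hρ.posSemidef]
    simp_rw [h]
    rw [← Complex.ofReal_sum, Complex.ofReal_re, hD.sum_prob hρ]
  have h3 := (h1.tendsto 0).mono_left (nhdsWithin_le_nhds (s := Set.Ioi 0))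
  rw [h2] at h3
  refine h3.congr' ?_
  filter_upwards [self_mem_nhdsWithin] with ε hε
  rw [trace_exp_comparisonGenerator hρ hε]

theorem Implements.entropy_evolved_le (hD : D.Implements M) {ρ : Matrix s s ℂ}
    (hρ : IsState ρ) :
    entropy (D.evolved ρ) ≤
      ∑ k, M.prob ρ k * entropy (M.post ρ k) + entropy (D.finalMemory ρ) := by
  have hlim : Tendsto (fun ε => -(D.evolved ρ * comparisonGenerator D M ρ ε).trace.re +
      Real.log (NormedSpace.exp (comparisonGenerator D M ρ ε)).trace.re) (𝓝[>] 0)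
      (𝓝 (-(∑ k, M.prob ρ k * -entropy (M.post ρ k) + -entropy (D.finalMemory ρ)) +
        Real.log 1)) := by
    simp_rw [hD.trace_evolved_mul_comparisonGenerator hρ]
    refine Tendsto.add (Tendsto.neg (Tendsto.add (tendsto_finsetSum _ fun k _ => ?_) ?_)) ?_
    · exact (tendsto_trace_mul_shiftedLog (M.posSemidef_post hρ.posSemidef k).1).const_mul _
    · exact tendsto_trace_mul_shiftedLog (D.posSemidef_finalMemory hρ).1
    · exact (hD.tendsto_trace_exp_comparisonGenerator hρ).log one_ne_zero
  -- The variational bound needs only a Hermitian generator, so it holds for every real `ε`;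
  -- positivity of `ε` matters only for evaluating the limit.
  have h := ge_of_tendsto' hlim fun ε => entropy_le_neg_trace_mul_add_log_trace_exp
    (D.isState_evolved hρ) (isHermitian_comparisonGenerator ρ ε)
  simpa [Finset.sum_neg_distrib, add_comm] using h

theorem Implements.entropyDecrease_le (hD : D.Implements M) {ρ : Matrix s s ℂ}
    (hρ : IsState ρ) :
    M.entropyDecrease ρ ≤ entropy (D.finalMemory ρ) - entropy D.memory := by
  have h := hD.entropy_evolved_le hρ
  rw [D.entropy_evolved hρ] at h
  rw [Measurement.entropyDecrease]
  linarith

end Device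

end Measurement

/-! ### The resetting step: Gibbs states and the free energy bound. -/

section Reset

variable {m b : Type*} [Fintype m] [DecidableEq m] [Fintype b] [DecidableEq b]

theorem smul_unitaryDiag (c : ℝ) (V : Matrix b b ℂ) (d : b → ℝ) :
    (c : ℂ) • unitaryDiag V d = unitaryDiag V (fun i => c * d i) := by
  have h : diagonal (fun i => ((c * d i : ℝ) : ℂ)) = (c : ℂ) • diagonal (fun i => (d i : ℂ)) := by
    rw [← diagonal_smul]
    congr 1
    ext i
    simp
  rw [unitaryDiag, unitaryDiag, h, Matrix.mul_smul, Matrix.smul_mul]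

theorem posSemidef_unitaryDiag (V : Matrix b b ℂ) {d : b → ℝ} (hd : ∀ i, 0 ≤ d i) :
    (unitaryDiag V d).PosSemidef :=
  (PosSemidef.diagonal fun i => by simpa using hd i).mul_mul_conjTranspose_same V

theorem energy_sub (H ρ σ : Matrix b b ℂ) : energy H (ρ - σ) = energy H ρ - energy H σ := by
  simp [energy, Matrix.mul_sub]

/-- The Gibbs state is a state, its partition function is positive, and
`S = ⟨H⟩ / kT + log Z`. -/
theorem thermalState_properties [Nonempty b] (kT : ℝ) {H : Matrix b b ℂ} (hH : H.IsHermitian) :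
    IsState (thermalState kT H) ∧
      0 < (NormedSpace.exp (-((kT⁻¹ : ℝ) : ℂ) • H)).trace.re ∧
      entropy (thermalState kT H) = kT⁻¹ * energy H (thermalState kT H) +
        Real.log (NormedSpace.exp (-((kT⁻¹ : ℝ) : ℂ) • H)).trace.re := by
  obtain ⟨V, hV, hHV, -⟩ := exists_unitaryDiag_cfc hH
  generalize hH.eigenvalues = h at hHV
  have hexp : NormedSpace.exp (-((kT⁻¹ : ℝ) : ℂ) • H) =
      unitaryDiag V (fun i => Real.exp (-kT⁻¹ * h i)) := by
    rw [hHV, ← Complex.ofReal_neg, smul_unitaryDiag, exp_unitaryDiag hV]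
    rfl
  set Z : ℝ := ∑ i, Real.exp (-kT⁻¹ * h i) with hZdef
  have hZ : 0 < Z := Finset.sum_pos (fun i _ => Real.exp_pos _) Finset.univ_nonempty
  have htr : (NormedSpace.exp (-((kT⁻¹ : ℝ) : ℂ) • H)).trace = (Z : ℂ) := by
    rw [hexp, trace_unitaryDiag hV]
  have hth : thermalState kT H = unitaryDiag V (fun i => Z⁻¹ * Real.exp (-kT⁻¹ * h i)) := by
    rw [thermalState, htr, hexp, ← Complex.ofReal_inv, smul_unitaryDiag]
  have hsum : ∑ i, Z⁻¹ * Real.exp (-kT⁻¹ * h i) = 1 := by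
    rw [← Finset.mul_sum, inv_mul_cancel₀ hZ.ne']
  rw [htr, Complex.ofReal_re]
  refine ⟨⟨?_, ?_⟩, hZ, ?_⟩
  · rw [hth]
    exact posSemidef_unitaryDiag V fun i => by positivity
  · rw [hth, trace_unitaryDiag hV, hsum, Complex.ofReal_one]
  · rw [energy, hth, entropy_unitaryDiag hV, hHV, unitaryDiag_mul hV, trace_unitaryDiag hV,
      Complex.ofReal_re]
    calc ∑ i, Real.negMulLog (Z⁻¹ * Real.exp (-kT⁻¹ * h i))
        = ∑ i, (kT⁻¹ * (h i * (Z⁻¹ * Real.exp (-kT⁻¹ * h i))) +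
            Z⁻¹ * Real.exp (-kT⁻¹ * h i) * Real.log Z) := by
          refine Finset.sum_congr rfl fun i _ => ?_
          rw [Real.negMulLog, Real.log_mul (inv_pos.2 hZ).ne' (Real.exp_pos _).ne', Real.log_exp,
            Real.log_inv]
          ring
      _ = _ := by
          rw [Finset.sum_add_distrib, ← Finset.mul_sum, ← Finset.sum_mul, hsum, one_mul]
          rfl

theorem energy_kronecker_one_add (HM : Matrix m m ℂ) (HB : Matrix b b ℂ)
    (ω : Matrix (m × b) (m × b) ℂ) :
    energy (HM ⊗ₖ (1 : Matrix b b ℂ) + (1 : Matrix m m ℂ) ⊗ₖ HB) ω =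
      energy HM (traceSnd ω) + energy HB (traceFst ω) := by
  rw [energy, Matrix.add_mul, trace_add, trace_mul_comm, trace_mul_kronecker_one, trace_mul_comm,
    trace_mul_comm (_ ⊗ₖ HB), trace_mul_one_kronecker, trace_mul_comm _ HB, Complex.add_re]
  rfl

/-- A joint state of memory and bath has entropy at most that of its memory marginal plus the
cross entropy of its bath marginal with the Gibbs state. -/
theorem entropy_le_entropy_traceSnd_add {kT : ℝ} [Nonempty b] {H : Matrix b b ℂ}
    (hH : H.IsHermitian) {ω : Matrix (m × b) (m × b) ℂ} (hω : IsState ω)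
    (hτ : IsState (traceSnd ω)) :
    entropy ω ≤ entropy (traceSnd ω) + kT⁻¹ * energy H (traceFst ω) +
      Real.log (NormedSpace.exp (-((kT⁻¹ : ℝ) : ℂ) • H)).trace.re := by
  set τ := traceSnd ω
  set G := -((kT⁻¹ : ℝ) : ℂ) • H with hG
  have hGH : G.IsHermitian := by
    rw [hG, IsHermitian, conjTranspose_smul, hH.eq]
    simp
  have hZ : 0 < (NormedSpace.exp G).trace.re := (thermalState_properties kT hH).2.1
  -- At `ε = 0` and for invertible `τ`, this is the logarithm of the unnormalised product `τ ⊗ exp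
  -- (-H / kT)`.
  let K : ℝ → Matrix (m × b) (m × b) ℂ := fun ε =>
    shiftedLog ε τ ⊗ₖ (1 : Matrix b b ℂ) + (1 : Matrix m m ℂ) ⊗ₖ G
  have hK : ∀ ε, (K ε).IsHermitian := fun ε => by
    simp only [K, IsHermitian, conjTranspose_add, conjTranspose_kronecker, conjTranspose_one,
      (isHermitian_shiftedLog ε τ).eq, hGH.eq]
  have htr : ∀ ε, (ω * K ε).trace.re =
      (τ * shiftedLog ε τ).trace.re - kT⁻¹ * energy H (traceFst ω) := fun ε => by
    rw [Matrix.mul_add, trace_add, trace_mul_kronecker_one, trace_mul_one_kronecker, energy,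
      hG, Matrix.mul_smul, trace_smul, trace_mul_comm _ H, Complex.add_re, ← Complex.ofReal_neg,
      smul_eq_mul, Complex.re_ofReal_mul]
    ring
  have hexp : ∀ ε, 0 < ε → (NormedSpace.exp (K ε)).trace =
      (τ + (ε : ℂ) • 1).trace * (NormedSpace.exp G).trace := fun ε hε => by
    have hcomm : Commute (shiftedLog ε τ ⊗ₖ (1 : Matrix b b ℂ)) ((1 : Matrix m m ℂ) ⊗ₖ G) := by
      rw [Commute, SemiconjBy, ← mul_kronecker_mul, ← mul_kronecker_mul]
      simp only [Matrix.mul_one, Matrix.one_mul]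
    rw [exp_add_of_commute _ _ hcomm, exp_kronecker_one, exp_one_kronecker,
      exp_shiftedLog hτ.posSemidef hε, ← mul_kronecker_mul, Matrix.mul_one, Matrix.one_mul,
      trace_kronecker]
  have hexplim : Tendsto (fun ε => (NormedSpace.exp (K ε)).trace.re) (𝓝[>] 0)
      (𝓝 (NormedSpace.exp G).trace.re) := by
    have h1 : Continuous fun ε : ℝ =>
        ((τ + (ε : ℂ) • 1).trace * (NormedSpace.exp G).trace).re := by
      simp only [trace_add, trace_smul, smul_eq_mul]
      fun_prop
    have h3 := (h1.tendsto 0).mono_left (nhdsWithin_le_nhds (s := Set.Ioi 0))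
    simp only [Complex.ofReal_zero, zero_smul, add_zero, hτ.trace_eq_one, one_mul] at h3
    refine h3.congr' ?_
    filter_upwards [self_mem_nhdsWithin] with ε hε
    rw [hexp ε hε]
  have hlim : Tendsto (fun ε => -(ω * K ε).trace.re + Real.log (NormedSpace.exp (K ε)).trace.re)
      (𝓝[>] 0) (𝓝 (-(-entropy τ - kT⁻¹ * energy H (traceFst ω)) +
        Real.log (NormedSpace.exp G).trace.re)) := by
    simp_rw [htr]
    exact ((tendsto_trace_mul_shiftedLog hτ.posSemidef.1).sub_const _).neg.add
      (hexplim.log hZ.ne')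
  have h := ge_of_tendsto' hlim fun ε => entropy_le_neg_trace_mul_add_log_trace_exp hω (hK ε)
  linarith

/-- No resetting process with a thermal bath is cheaper than minus the free energy change of the
memory. -/
theorem ResetProcess.neg_freeEnergy_sub_le_cost (R : ResetProcess m b) {kT : ℝ} (hkT : 0 < kT)
    (HM : Matrix m m ℂ) {σ τ : Matrix m m ℂ} (hσ : IsState σ) (hτ : IsState τ)
    (hR : R.Resets kT σ τ) :
    -(freeEnergy kT HM σ - freeEnergy kT HM τ) ≤ R.cost kT HM σ := by
  -- A positive partition function needs a nonempty bath; over an empty one the final state has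
  -- trace zero and cannot restore `τ`.
  rcases isEmpty_or_nonempty b with hb | hb
  · have h := hτ.trace_eq_one
    rw [← hR, trace_traceSnd] at h
    simp [trace] at h
  obtain ⟨hB, -, hSB⟩ := thermalState_properties kT R.bathHamiltonian_isHermitian
  have hinit : IsState (R.initialState kT σ) := hσ.kronecker hB
  have hfin : IsState (R.finalState kT σ) := hinit.unitary_conj R.unitary_mem
  have hS : entropy (R.finalState kT σ) =
      entropy σ + entropy (thermalState kT R.bathHamiltonian) := by
    rw [ResetProcess.finalState, entropy_unitary_conj R.unitary_mem hinit.posSemidef.1,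
      ResetProcess.initialState, entropy_kronecker hσ hB]
  have hle := entropy_le_entropy_traceSnd_add (kT := kT) R.bathHamiltonian_isHermitian hfin
    (by rw [hR]; exact hτ)
  -- Both sides now contain `log Z`, which cancels and leaves only the change of bath energy over
  -- `kT`.
  rw [hS, hSB, hR] at hle
  rw [ResetProcess.cost, energy_sub, energy_kronecker_one_add, energy_kronecker_one_add, hR,
    ResetProcess.initialState, traceSnd_kronecker, traceFst_kronecker, hB.trace_eq_one,
    hσ.trace_eq_one, one_smul, one_smul, freeEnergy, freeEnergy]
  have h : kT * (kT⁻¹ * energy R.bathHamiltonian (thermalState kT R.bathHamiltonian)) =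
      energy R.bathHamiltonian (thermalState kT R.bathHamiltonian) :=
    mul_inv_cancel_left₀ hkT.ne' _
  have h' : kT * (kT⁻¹ * energy R.bathHamiltonian (traceFst (R.finalState kT σ))) =
      energy R.bathHamiltonian (traceFst (R.finalState kT σ)) :=
    mul_inv_cancel_left₀ hkT.ne' _
  have := mul_le_mul_of_nonneg_left hle hkT.le
  linarith

end Reset

end MeasurementCost

/-! ### The total cost in both cases. -/

theorem mainTheorem2
    {s m κ : Type*} {ι : κ → Type*}
    [Fintype s] [DecidableEq s] [Fintype m] [DecidableEq m] [Fintype κ] [∀ k, Fintype (ι k)]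
    (kB T : ℝ) (hkB : 0 < kB) (hT : 0 < T)
    (HS : Matrix s s ℂ) (hHS : HS.IsHermitian)
    (HM : Matrix m m ℂ) (hHM : HM.IsHermitian)
    (M : MeasurementCost.Measurement s κ ι)
    (D : MeasurementCost.Device s m κ) (hD : D.Implements M)
    (ρS : Matrix s s ℂ) (hρS : MeasurementCost.IsState ρS) :
    -- the resetting step is optimal: its cost is minus the free energy change of the memory
    (M.systemEnergyChange HS ρS + kB * T * M.entropyDecrease ρS ≤
      D.measurementCost M HS HM ρS + D.optimalResetCost (kB * T) HM ρS) ∧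
    -- the resetting step is any unitary process with a thermal bath that restores the memory
    (∀ (b : Type*) [Fintype b] [DecidableEq b] (R : MeasurementCost.ResetProcess m b),
      R.Resets (kB * T) (D.finalMemory ρS) D.memory →
      M.systemEnergyChange HS ρS + kB * T * M.entropyDecrease ρS ≤
        D.measurementCost M HS HM ρS + R.cost (kB * T) HM (D.finalMemory ρS)) := by
  have hkT : 0 < kB * T := mul_pos hkB hT
  have hopt : M.systemEnergyChange HS ρS + kB * T * M.entropyDecrease ρS ≤
      D.measurementCost M HS HM ρS + D.optimalResetCost (kB * T) HM ρS := by
    -- The memory energy paid in the measurement is recovered in the free energy difference, leaving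
    -- `kB * T` times the entropy gain of the memory.
    have h := mul_le_mul_of_nonneg_left (hD.entropyDecrease_le hρS) hkT.le
    rw [MeasurementCost.Device.measurementCost, MeasurementCost.Device.optimalResetCost,
      MeasurementCost.energy_sub, MeasurementCost.freeEnergy, MeasurementCost.freeEnergy]
    linarith
  refine ⟨hopt, fun b _ _ R hR => hopt.trans ?_⟩
  have h := R.neg_freeEnergy_sub_le_cost hkT HM (D.isState_finalMemory hρS) D.memory_isState hR
  rw [MeasurementCost.Device.optimalResetCost]
  linarith
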